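/- Let $\mathcal H$ and $\mathcal V$ be complex Hilbert spaces, with $\mathcal V$ continuously and densely embedded in $\mathcal H$. Let $a:\mathcal V\times\mathcal V\to\mathbb C$ be a sesquilinear form (linear in the first variable) that is continuous ($|a(f,g)|\le M\|f\|_{\mathcal V}\|g\|_{\mathcal V}$ for some $M$), symmetric ($a(f,g)=\overline{a(g,f)}$) and $\mathcal H$-elliptic: there are $\omega\in\mathbb R$ and $\alpha>0$ such that $\operatorname{Re}a(f,f)+\omega\|f\|_{\mathcal H}^2\ge\alpha\|f\|_{\mathcal V}^2$ for all $f\in\mathcal V$. Let $A$ be the operator on $\mathcal H$ associated with $a$: $f\in D(A)$ and $Af=g$ if and only if $f\in\mathcal V$, $g\in\mathcal H$ and $a(f,h)=-(g\,|\,h)_{\mathcal H}$ for all $h\in\mathcal V$. Then there is exactly one strongly continuous semigroup $(e^{tA})_{t\ge0}$ of bounded linear operators on $\mathcal H$ whose generator is $A$. Moreover, if $\mathcal P$ is an orthogonal projection of $\mathcal H$ onto a closed subspace, then the following assertions are equivalent. (a) The range of $\mathcal P$ is invariant under $(e^{tA})_{t\ge0}$, i.e. $e^{tA}(\operatorname{range}\mathcal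 P)\subseteq\operatorname{range}\mathcal P$ for all $t\ge0$. (b) If $\psi\in\mathcal V$, then $\mathcal P\psi\in\mathcal V$ and $a(\mathcal P\psi,\psi)=a(\mathcal P\psi,\mathcal P\psi)$. (c) If $\psi\in\mathcal V$, then $e^{is\mathcal P}\psi\in\mathcal V$ and $a(\psi,\psi)=a(e^{is\mathcal P}\psi,e^{is\mathcal P}\psi)$ for all $s\in\mathbb R$. -/

import Mathlib

open scoped NNReal Topology InnerProductSpace ComplexConjugate

/-- A strongly continuous one-parameter semigroup `(T t)_{t ≥ 0}` of bounded linear operators on a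
complex normed space. -/
structure C0Semigroup (E : Type*) [NormedAddCommGroup E] [NormedSpace ℂ E] where
  /-- The operator of the semigroup at time `t`. -/
  op : ℝ≥0 → E →L[ℂ] E
  op_zero : op 0 = ContinuousLinearMap.id ℂ E
  op_add : ∀ s t : ℝ≥0, op (s + t) = (op s).comp (op t)
  continuous_orbit : ∀ x : E, Continuous fun t : ℝ≥0 => op t x

namespace C0Semigroup

variable {E : Type*} [NormedAddCommGroup E] [NormedSpace ℂ E]

/-- The graph of the generator: all pairs `(x, y)` with `(T t x - x) / t → y` as `t → 0+`. -/
def generatorGraph (T : C0Semigroup E) : Submodule ℂ (E × E) where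
  carrier := {p | Filter.Tendsto (fun t : ℝ≥0 => (t : ℝ)⁻¹ • (T.op t p.1 - p.1)) (𝓝[>] 0) (𝓝 p.2)}
  zero_mem' := by
    simp only [Set.mem_ofPred_eq, Prod.fst_zero, Prod.snd_zero, map_zero, sub_zero, smul_zero]
    exact tendsto_const_nhds
  add_mem' := by
    intro p q hp hq
    refine (Filter.Tendsto.add hp hq).congr fun t => ?_
    simp only [Prod.fst_add, map_add, ← smul_add]
    congr 1
    abel
  smul_mem' := by
    intro c p hp
    refine (Filter.Tendsto.const_smul hp c).congr fun t => ?_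
    simp only [Prod.smul_fst, map_smul, ← smul_sub]
    rw [smul_comm]

/-- The (infinitesimal) generator of the semigroup: the unbounded operator whose domain is the set
of all `x` for which `y = lim_{t → 0+} (T t x - x) / t` exists, and which maps such an `x` to `y`. -/
noncomputable def generator (T : C0Semigroup E) : E →ₗ.[ℂ] E :=
  T.generatorGraph.toLinearPMap

theorem generator_graph (T : C0Semigroup E) : T.generator.graph = T.generatorGraph := by
  refine Submodule.toLinearPMap_graph_eq _ ?_
  rintro ⟨x, y⟩ hx (h0 : x = 0)
  subst h0
  have hx' : Filter.Tendsto (fun t : ℝ≥0 => (t : ℝ)⁻¹ • (T.op t 0 - 0)) (𝓝[>] 0) (𝓝 y) := hx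
  simp only [map_zero, sub_zero, smul_zero] at hx'
  exact tendsto_nhds_unique hx' tendsto_const_nhds

theorem mem_generator_graph (T : C0Semigroup E) (x y : E) :
    (x, y) ∈ T.generator.graph ↔
      Filter.Tendsto (fun t : ℝ≥0 => (t : ℝ)⁻¹ • (T.op t x - x)) (𝓝[>] 0) (𝓝 y) := by
  rw [generator_graph]
  exact Iff.rfl

end C0Semigroup

section Form

variable {H V : Type*} [NormedAddCommGroup H] [InnerProductSpace ℂ H]
  [NormedAddCommGroup V] [InnerProductSpace ℂ V]

/-- Let `V` be embedded into `H` by `j`, and let `a` be a sesquilinear form on `V` (linear in the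
first, conjugate linear in the second variable). This is the graph of the operator `A` associated
with `a`: all pairs `(j f, g)` with `f ∈ V` and `a(f, h) = -(g | h)` for all `h ∈ V`.
Here `(x | y)`, linear in `x`, is Mathlib's `⟪y, x⟫_ℂ`. The sign is the one for which `A` (and not
`-A`) generates a semigroup; the form `∫ ∇ f · conj (∇ g)` yields the Laplacian. -/
def formOperatorGraph (j : V →L[ℂ] H) (a : V →ₗ[ℂ] V →ₗ⋆[ℂ] ℂ) : Submodule ℂ (H × H) where
  carrier := {p | ∃ f : V, j f = p.1 ∧ ∀ h : V, a f h = -⟪j h, p.2⟫_ℂ}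
  zero_mem' := ⟨0, by simp, fun h => by simp⟩
  add_mem' := by
    rintro p q ⟨f, hf, hf'⟩ ⟨g, hg, hg'⟩
    refine ⟨f + g, by simp [hf, hg], fun h => ?_⟩
    simp only [map_add, LinearMap.add_apply, hf', hg', Prod.snd_add, inner_add_right]
    ring
  smul_mem' := by
    rintro c p ⟨f, hf, hf'⟩
    refine ⟨c • f, by simp [hf], fun h => ?_⟩
    simp only [map_smul, LinearMap.smul_apply, hf', Prod.smul_snd, inner_smul_right, smul_eq_mul]
    ring

/-- The operator `A` associated with the form `a`: `f ∈ D(A)` and `A f = g` if and only if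
`f ∈ V` and `a(f, h) = -(g | h)` for all `h ∈ V`. -/
noncomputable def formOperator (j : V →L[ℂ] H) (a : V →ₗ[ℂ] V →ₗ⋆[ℂ] ℂ) : H →ₗ.[ℂ] H :=
  (formOperatorGraph j a).toLinearPMap

theorem mem_formOperator_graph {j : V →L[ℂ] H} (hj : Function.Injective j) (hd : DenseRange j)
    (a : V →ₗ[ℂ] V →ₗ⋆[ℂ] ℂ) (x y : H) :
    (x, y) ∈ (formOperator j a).graph ↔
      ∃ f : V, j f = x ∧ ∀ h : V, a f h = -⟪j h, y⟫_ℂ := by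
  have key : (formOperator j a).graph = formOperatorGraph j a := by
    refine Submodule.toLinearPMap_graph_eq _ ?_
    rintro ⟨x, y⟩ ⟨f, hf, hf'⟩ (h0 : x = 0)
    have f0 : f = 0 := hj (by rw [map_zero, ← h0]; exact hf)
    subst f0
    refine hd.eq_zero_of_inner_right ℂ ?_
    intro h
    simpa using (hf' h).symm
  rw [key]
  exact Iff.rfl

/-- `a` is continuous (bounded) on `V`. -/
def FormContinuous (a : V →ₗ[ℂ] V →ₗ⋆[ℂ] ℂ) : Prop :=
  ∃ M : ℝ, ∀ f g : V, ‖a f g‖ ≤ M * ‖f‖ * ‖g‖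

/-- `a` is `H`-elliptic: `Re a(f, f) + ω ‖f‖_H² ≥ α ‖f‖_V²` for some real `ω` and some `α > 0`. -/
def FormElliptic (j : V →L[ℂ] H) (a : V →ₗ[ℂ] V →ₗ⋆[ℂ] ℂ) : Prop :=
  ∃ ω α : ℝ, 0 < α ∧ ∀ f : V, α * ‖f‖ ^ 2 ≤ (a f f).re + ω * ‖j f‖ ^ 2

/-- `a` is symmetric. -/
def FormSymmetric (a : V →ₗ[ℂ] V →ₗ⋆[ℂ] ℂ) : Prop :=
  ∀ f g : V, a f g = conj (a g f)

end Form

open Filter Set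

/-! By Lax–Milgram the shifted form `a + ω (· | ·)_H` is inverted by a bounded `S : H → V`, and `R =
j S` is the resolvent `(ω - A)⁻¹`: bounded, positive, injective. So `A = ω - R⁻¹`, and only the
continuous functional calculus of `R` is needed: `e^{tA}` is `e^{ωt}` times the value at `R` of `r ↦
exp (-t / r)`, continued by `0` to `r = 0` (`mem_graph_ofPositiveResolvent`). Uniqueness is
Gronwall's inequality for the squared norm of the difference of two orbits (`ext_of_generator_eq`).

As `e^{tA}` is self-adjoint, (a) says that `P` commutes with every `e^{tA}`, equivalently with `R`.
If so, `P` is an orthogonal projection for the shifted form on the range of `S`, hence bounded there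
in the norm of `V`, and density gives (b) (`exists_form_projection_of_commute`). Conversely,
polarizing (b) moves `P` across the form, so `P` commutes with `R`
(`commute_of_exists_form_projection`). Since `e^{isP} = 1 - P + e^{is} P`, (c) says that rotating
the component in the range of `P` preserves the form, i.e. that the cross terms vanish, which is
(b). -/

theorem expNegInvGlue_div {r t : ℝ} (hr : 0 < r) (ht : 0 < t) :
    expNegInvGlue (r / t) = Real.exp (-(t / r)) := by
  simp [expNegInvGlue, not_le.2 (div_pos hr ht)]

theorem expNegInvGlue_le_one (x : ℝ) : expNegInvGlue x ≤ 1 := by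
  rcases le_or_gt x 0 with h | h
  · simp [expNegInvGlue.zero_of_nonpos h]
  · simp [expNegInvGlue, not_le.2 h, h.le]

theorem Real.exp_neg_le_one_sub_add_sq {u : ℝ} (hu : 0 ≤ u) : Real.exp (-u) ≤ 1 - u + u ^ 2 := by
  have h1 : 1 + u ≤ Real.exp u := by linarith [Real.add_one_le_exp u]
  rw [Real.exp_neg, inv_le_iff_one_le_mul₀ (Real.exp_pos u)]
  have h2 : 0 ≤ 1 - u + u ^ 2 := by nlinarith [sq_nonneg (u - 1)]
  nlinarith [mul_le_mul_of_nonneg_left h1 h2, pow_nonneg hu 3]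

theorem Real.abs_exp_neg_sub_exp_neg_le {u v : ℝ} (hu : 0 ≤ u) (hv : 0 ≤ v) :
    |Real.exp (-u) - Real.exp (-v)| ≤ |u - v| := by
  wlog h : u ≤ v generalizing u v
  · rw [abs_sub_comm, abs_sub_comm u]
    exact this hv hu (le_of_not_ge h)
  rw [abs_of_nonneg (by simpa using h), abs_of_nonpos (by linarith)]
  have h1 : Real.exp (-v) = Real.exp (-u) * Real.exp (-(v - u)) := by
    rw [← Real.exp_add]; ring_nf
  have h2 := Real.one_sub_le_exp_neg (v - u)
  have h3 : Real.exp (-u) ≤ 1 := by simpa using hu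
  nlinarith [Real.exp_pos (-u), mul_le_mul_of_nonneg_left h2 (Real.exp_pos (-u)).le]

/-! ### The semigroup generated by `ω - R⁻¹` for an injective positive operator `R` -/

section Positive

variable {H : Type*} [NormedAddCommGroup H] [InnerProductSpace ℂ H] [CompleteSpace H]

/-- For a positive operator `R`, the contraction `exp (-t R⁻¹)`, obtained from the continuous
functional calculus of `R`. -/
noncomputable def expNegInv (R : H →L[ℂ] H) (t : ℝ≥0) : H →L[ℂ] H :=
  -- At `t = 0` the convention `r / 0 = 0` would produce the zero operator instead of the identity.
  if t = 0 then 1 else cfc (fun r : ℝ => expNegInvGlue (r / t)) R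

theorem continuous_expNegInvGlue_div (t : ℝ) :
    Continuous fun r : ℝ => expNegInvGlue (r / t) :=
  (expNegInvGlue.contDiff (n := 0)).continuous.comp (continuous_id.div_const t)

variable {R : H →L[ℂ] H}

@[simp]
theorem expNegInv_zero : expNegInv R 0 = 1 := if_pos rfl

theorem expNegInv_of_ne_zero {t : ℝ≥0} (ht : t ≠ 0) :
    expNegInv R t = cfc (fun r : ℝ => expNegInvGlue (r / t)) R := if_neg ht

theorem isSelfAdjoint_expNegInv (t : ℝ≥0) : IsSelfAdjoint (expNegInv R t) := by
  unfold expNegInv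
  split_ifs
  · exact .one _
  · exact cfc_predicate _ R

theorem norm_expNegInv_le (t : ℝ≥0) : ‖expNegInv R t‖ ≤ 1 := by
  unfold expNegInv
  split_ifs
  · exact ContinuousLinearMap.norm_id_le
  · refine norm_cfc_le zero_le_one fun r _ => ?_
    rw [Real.norm_of_nonneg (expNegInvGlue.nonneg _)]
    exact expNegInvGlue_le_one _

theorem norm_expNegInv_apply_le (t : ℝ≥0) (x : H) : ‖expNegInv R t x‖ ≤ ‖x‖ := by
  simpa using (expNegInv R t).le_of_opNorm_le (norm_expNegInv_le t) x

theorem commute_expNegInv {P : H →L[ℂ] H} (h : Commute R P) (t : ℝ≥0) :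
    Commute (expNegInv R t) P := by
  unfold expNegInv
  split_ifs
  · exact .one_left _
  · exact h.cfc_real _

theorem expNegInv_add (hR : 0 ≤ R) (s t : ℝ≥0) :
    expNegInv R (s + t) = expNegInv R s * expNegInv R t := by
  rcases eq_or_ne s 0 with rfl | hs
  · simp
  rcases eq_or_ne t 0 with rfl | ht
  · simp
  have hs' : (0 : ℝ) < s := by exact_mod_cast pos_iff_ne_zero.2 hs
  have ht' : (0 : ℝ) < t := by exact_mod_cast pos_iff_ne_zero.2 ht
  rw [expNegInv_of_ne_zero hs, expNegInv_of_ne_zero ht, expNegInv_of_ne_zero (by simp [hs]),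
    ← cfc_mul _ _ R (continuous_expNegInvGlue_div _).continuousOn
      (continuous_expNegInvGlue_div _).continuousOn]
  refine cfc_congr fun r hr => ?_
  rcases (spectrum_nonneg_of_nonneg hR hr).eq_or_lt with rfl | hr
  · simp [expNegInvGlue.zero]
  · simp only [NNReal.coe_add]
    rw [expNegInvGlue_div hr hs', expNegInvGlue_div hr ht', expNegInvGlue_div hr (by positivity),
      ← Real.exp_add]
    ring_nf

/-- The function whose functional calculus is `exp (-t R⁻¹) R`. -/
noncomputable def mulExpNegInv (t r : ℝ) : ℝ := if t = 0 then r else expNegInvGlue (r / t) * r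

theorem continuous_mulExpNegInv (t : ℝ) : Continuous (mulExpNegInv t) := by
  unfold mulExpNegInv
  split_ifs
  · exact continuous_id
  · exact (continuous_expNegInvGlue_div t).mul continuous_id

theorem mulExpNegInv_of_pos {t r : ℝ} (ht : 0 ≤ t) (hr : 0 < r) :
    mulExpNegInv t r = Real.exp (-(t / r)) * r := by
  rcases ht.eq_or_lt with rfl | ht
  · simp [mulExpNegInv]
  · rw [mulExpNegInv, if_neg ht.ne', expNegInvGlue_div hr ht]

theorem mulExpNegInv_zero (t : ℝ) : mulExpNegInv t 0 = 0 := by simp [mulExpNegInv]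

theorem expNegInv_mul (hR : 0 ≤ R) (t : ℝ≥0) :
    expNegInv R t * R = cfc (mulExpNegInv t) R := by
  have hsa : IsSelfAdjoint R := .of_nonneg hR
  rcases eq_or_ne t 0 with rfl | ht
  · rw [expNegInv_zero, one_mul]
    conv_lhs => rw [← cfc_id' ℝ R]
    exact cfc_congr fun r _ => by simp [mulExpNegInv]
  · rw [expNegInv_of_ne_zero ht]
    nth_rw 2 [← cfc_id' ℝ R]
    rw [← cfc_mul _ _ R (continuous_expNegInvGlue_div _).continuousOn]
    refine cfc_congr fun r _ => ?_
    simp [mulExpNegInv, ht]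

/-- The factor `r` cancels the denominator in `|s / r - t / r|`, so orbits starting in the range of
`R` are Lipschitz. -/
theorem norm_expNegInv_mul_sub_le (hR : 0 ≤ R) (s t : ℝ≥0) :
    ‖expNegInv R s * R - expNegInv R t * R‖ ≤ |(s : ℝ) - t| := by
  rw [expNegInv_mul hR, expNegInv_mul hR, ← cfc_sub _ _ R
    (continuous_mulExpNegInv _).continuousOn (continuous_mulExpNegInv _).continuousOn]
  refine norm_cfc_le (abs_nonneg _) fun r hr => ?_
  rcases (spectrum_nonneg_of_nonneg hR hr).eq_or_lt with rfl | hr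
  · simp [mulExpNegInv_zero]
  · rw [mulExpNegInv_of_pos s.coe_nonneg hr, mulExpNegInv_of_pos t.coe_nonneg hr, ← sub_mul, norm_mul,
      Real.norm_eq_abs, Real.norm_of_nonneg hr.le]
    refine (mul_le_mul_of_nonneg_right (Real.abs_exp_neg_sub_exp_neg_le
      (div_nonneg s.coe_nonneg hr.le) (div_nonneg t.coe_nonneg hr.le)) hr.le).trans_eq ?_
    rw [← sub_div, abs_div, abs_of_pos hr, div_mul_cancel₀ _ hr.ne']

/-- Second-order expansion of `exp (-t / r)`: the factor `r ^ 2` makes the remainder `(t / r) ^ 2`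
uniform over the spectrum. -/
theorem norm_expNegInv_mul_mul_sub_add_le (hR : 0 ≤ R) (t : ℝ≥0) :
    ‖expNegInv R t * R * R - R * R + (t : ℝ) • R‖ ≤ (t : ℝ) ^ 2 := by
  have hsa : IsSelfAdjoint R := .of_nonneg hR
  have key : expNegInv R t * R * R - R * R + (t : ℝ) • R
      = cfc (fun r => mulExpNegInv t r * r - r * r + t * r) R := by
    have h1 := continuous_mulExpNegInv t
    rw [cfc_add R (fun r => mulExpNegInv t r * r - r * r) (fun r => t * r)
        (by fun_prop) (by fun_prop),
      cfc_sub (fun r => mulExpNegInv t r * r) (fun r => r * r) R (by fun_prop) (by fun_prop),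
      cfc_mul (mulExpNegInv t) (fun r => r) R (by fun_prop) (by fun_prop),
      cfc_mul (fun r : ℝ => r) (fun r => r) R (by fun_prop) (by fun_prop),
      cfc_const_mul (t : ℝ) (fun r => r) R (by fun_prop), cfc_id' ℝ R, expNegInv_mul hR]
  rw [key]
  refine norm_cfc_le (by positivity) fun r hr => ?_
  rcases (spectrum_nonneg_of_nonneg hR hr).eq_or_lt with rfl | hr
  · simp only [mul_zero, sub_zero, add_zero, norm_zero]; positivity
  · rw [mulExpNegInv_of_pos t.coe_nonneg hr]
    have h0 : (0 : ℝ) ≤ t / r := div_nonneg t.coe_nonneg hr.le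
    have h1 := Real.exp_neg_le_one_sub_add_sq h0
    have h2 := Real.one_sub_le_exp_neg (t / r : ℝ)
    have h3 : Real.exp (-(t / r)) * r * r - r * r + t * r
        = (Real.exp (-(t / r)) - (1 - t / r)) * r ^ 2 := by
      field_simp; ring
    have h4 : (t : ℝ) ^ 2 = (t / r) ^ 2 * r ^ 2 := by field_simp
    rw [h3, Real.norm_of_nonneg (mul_nonneg (by linarith) (by positivity)), h4]
    exact mul_le_mul_of_nonneg_right (by linarith) (by positivity)

theorem denseRange_of_nonneg_of_injective (hR : 0 ≤ R) (hinj : Function.Injective R) :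
    DenseRange R := by
  have h : IsSelfAdjoint R := .of_nonneg hR
  have h1 : R.rangeᗮ = ⊥ := by
    rw [ContinuousLinearMap.orthogonal_range, h.adjoint_eq]
    exact LinearMap.ker_eq_bot.2 hinj
  have := Submodule.dense_iff_topologicalClosure_eq_top.2
    ((Submodule.topologicalClosure_eq_top_iff (K := R.range)).2 h1)
  exact this

theorem continuous_expNegInv_apply (hR : 0 ≤ R) (hinj : Function.Injective R) (x : H) :
    Continuous fun t : ℝ≥0 => expNegInv R t x := by
  refine continuous_of_uniform_approx_of_continuous fun u hu => ?_
  obtain ⟨ε, hε, hεu⟩ := Metric.mem_uniformity_dist.1 hu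
  obtain ⟨y, hy⟩ := (denseRange_of_nonneg_of_injective hR hinj).exists_dist_lt x hε
  refine ⟨fun t => expNegInv R t (R y), ?_, fun t => hεu ?_⟩
  · refine (LipschitzWith.of_dist_le_mul (K := ‖y‖₊) fun s t => ?_).continuous
    have := (expNegInv R s * R - expNegInv R t * R).le_of_opNorm_le
      (norm_expNegInv_mul_sub_le hR s t) y
    rw [dist_eq_norm, NNReal.dist_eq, mul_comm]
    simpa using this
  · rw [dist_eq_norm, ← map_sub]
    exact (norm_expNegInv_apply_le t _).trans_lt (by rwa [← dist_eq_norm])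

/-- For `y = R z` this is the second-order estimate. A general `y` is approximated by such vectors,
since the difference quotients at `R v` are bounded by `‖v‖` uniformly in `t`. -/
theorem tendsto_expNegInv_slope (hR : 0 ≤ R) (hinj : Function.Injective R) (y : H) :
    Tendsto (fun t : ℝ≥0 => (t : ℝ)⁻¹ • (expNegInv R t (R y) - R y)) (𝓝[>] 0) (𝓝 (-y)) := by
  rw [Metric.tendsto_nhds]
  intro ε hε
  obtain ⟨z, hz⟩ := (denseRange_of_nonneg_of_injective hR hinj).exists_dist_lt y
    (by positivity : 0 < ε / 3)
  have hz' : ‖y - R z‖ < ε / 3 := by rwa [← dist_eq_norm]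
  have hsmall : ∀ᶠ t : ℝ≥0 in 𝓝[>] 0, (t : ℝ) * ‖z‖ < ε / 3 := by
    have : Tendsto (fun t : ℝ≥0 => (t : ℝ) * ‖z‖) (𝓝[>] 0) (𝓝 0) := by
      have h : Continuous fun t : ℝ≥0 => (t : ℝ) * ‖z‖ := by fun_prop
      simpa using (h.tendsto 0).mono_left nhdsWithin_le_nhds
    exact this.eventually_lt_const (by positivity)
  filter_upwards [hsmall, self_mem_nhdsWithin] with t ht ht0
  have ht0 : (0 : ℝ) < t := by exact_mod_cast ht0
  have h1 : ‖(t : ℝ)⁻¹ • (expNegInv R t (R (y - R z)) - R (y - R z))‖ ≤ ‖y - R z‖ := by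
    have := (expNegInv R t * R - expNegInv R 0 * R).le_of_opNorm_le
      (norm_expNegInv_mul_sub_le hR t 0) (y - R z)
    rw [norm_smul, norm_inv, Real.norm_of_nonneg ht0.le, inv_mul_le_iff₀ ht0]
    simpa using this
  have h2 : ‖(t : ℝ)⁻¹ • (expNegInv R t (R (R z)) - R (R z)) + R z‖ ≤ t * ‖z‖ := by
    have := (expNegInv R t * R * R - R * R + (t : ℝ) • R).le_of_opNorm_le
      (norm_expNegInv_mul_mul_sub_add_le hR t) z
    have e : (t : ℝ)⁻¹ • (expNegInv R t (R (R z)) - R (R z)) + R z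
        = (t : ℝ)⁻¹ • ((expNegInv R t * R * R - R * R + (t : ℝ) • R) z) := by
      simp [smul_add, smul_smul, inv_mul_cancel₀ ht0.ne']
    rw [e, norm_smul, norm_inv, Real.norm_of_nonneg ht0.le, inv_mul_le_iff₀ ht0]
    linarith
  have e : (t : ℝ)⁻¹ • (expNegInv R t (R y) - R y) - -y
      = (t : ℝ)⁻¹ • (expNegInv R t (R (y - R z)) - R (y - R z))
        + ((t : ℝ)⁻¹ • (expNegInv R t (R (R z)) - R (R z)) + R z) + (y - R z) := by
    simp only [map_sub, smul_sub]; abel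
  rw [dist_eq_norm, e]
  linarith [norm_add₃_le (a := (t : ℝ)⁻¹ • (expNegInv R t (R (y - R z)) - R (y - R z)))
    (b := (t : ℝ)⁻¹ • (expNegInv R t (R (R z)) - R (R z)) + R z) (c := y - R z)]

/-- The semigroup `exp (t (ω - R⁻¹))` for an injective positive operator `R`. -/
noncomputable def C0Semigroup.ofPositiveResolvent (R : H →L[ℂ] H) (hR : 0 ≤ R)
    (hinj : Function.Injective R) (ω : ℝ) : C0Semigroup H where
  op t := Real.exp (ω * t) • expNegInv R t
  op_zero := by simp; rfl
  op_add s t := by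
    have h := expNegInv_add hR s t
    rw [h]
    ext x
    simp [smul_smul, mul_add, Real.exp_add, mul_comm]
  continuous_orbit x := by
    have := continuous_expNegInv_apply hR hinj x
    have h2 : Continuous fun t : ℝ≥0 => Real.exp (ω * t) := by fun_prop
    exact h2.smul this

theorem C0Semigroup.ofPositiveResolvent_op (hR : 0 ≤ R) (hinj : Function.Injective R) (ω : ℝ)
    (t : ℝ≥0) (x : H) :
    (ofPositiveResolvent R hR hinj ω).op t x = Real.exp (ω * t) • expNegInv R t x := rfl

theorem C0Semigroup.isSelfAdjoint_ofPositiveResolvent_op (hR : 0 ≤ R)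
    (hinj : Function.Injective R) (ω : ℝ) (t : ℝ≥0) :
    IsSelfAdjoint ((ofPositiveResolvent R hR hinj ω).op t) := by
  rw [ContinuousLinearMap.isSelfAdjoint_iff_isSymmetric]
  intro x y
  have hs := (isSelfAdjoint_expNegInv (R := R) t).isSymmetric x y
  simp only [ContinuousLinearMap.coe_coe] at hs ⊢
  simp only [ofPositiveResolvent_op, ← Complex.coe_smul, inner_smul_left, inner_smul_right, hs,
    Complex.conj_ofReal]

theorem C0Semigroup.mem_graph_ofPositiveResolvent (hR : 0 ≤ R) (hinj : Function.Injective R)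
    (ω : ℝ) (x g : H) :
    (x, g) ∈ (ofPositiveResolvent R hR hinj ω).generator.graph ↔ x = R (ω • x - g) := by
  have hsymm : ∀ u v : H, ⟪R u, v⟫_ℂ = ⟪u, R v⟫_ℂ := by
    have := (IsSelfAdjoint.of_nonneg hR).isSymmetric
    exact this
  have hexp : Tendsto (fun t : ℝ≥0 => (t : ℝ)⁻¹ * (Real.exp (ω * t) - 1)) (𝓝[>] 0) (𝓝 ω) := by
    have h1 : HasDerivAt (fun t : ℝ => Real.exp (ω * t)) ω 0 := by
      simpa using ((hasDerivAt_id (0 : ℝ)).const_mul ω).exp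
    have h2 := hasDerivAt_iff_tendsto_slope_zero.1 h1
    have h3 : Tendsto (fun t : ℝ≥0 => (t : ℝ)) (𝓝[>] 0) (𝓝[≠] 0) := by
      refine tendsto_nhdsWithin_iff.2 ⟨?_, ?_⟩
      · exact (NNReal.continuous_coe.tendsto' 0 0 rfl).mono_left nhdsWithin_le_nhds
      · filter_upwards [self_mem_nhdsWithin] with t ht
        exact (by exact_mod_cast ht : (0 : ℝ) < t).ne'
    refine (h2.comp h3).congr fun t => ?_
    simp
  have hrange : ∀ y : H, (R y, ω • R y - y)
      ∈ (ofPositiveResolvent R hR hinj ω).generator.graph := by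
    intro y
    rw [mem_generator_graph]
    have hE : Tendsto (fun t : ℝ≥0 => Real.exp (ω * t)) (𝓝[>] 0) (𝓝 1) := by
      have h : Continuous fun t : ℝ≥0 => Real.exp (ω * t) := by fun_prop
      simpa using (h.tendsto 0).mono_left nhdsWithin_le_nhds
    have := (hE.smul (tendsto_expNegInv_slope hR hinj y)).add
      (hexp.smul (tendsto_const_nhds (x := R y)))
    rw [one_smul, neg_add_eq_sub] at this
    refine this.congr fun t => ?_
    rw [ofPositiveResolvent_op, mul_smul, smul_comm, ← smul_add, smul_sub, sub_smul, one_smul]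
    congr 1
    abel
  constructor
  · intro h
    rw [mem_generator_graph] at h
    -- No further element can lie in the graph: the generator is symmetric because the semigroup is
    -- self-adjoint, and pairing with the known elements `(R y, ω • R y - y)` determines `x`.
    have key : ∀ y : H, ⟪x, ω • R y - y⟫_ℂ = ⟪g, R y⟫_ℂ := by
      intro y
      have h1 := (mem_generator_graph _ _ _).1 (hrange y)
      refine tendsto_nhds_unique (tendsto_const_nhds.inner h1)
        ((h.inner (tendsto_const_nhds (x := R y))).congr fun t => ?_)
      have hs := (isSelfAdjoint_ofPositiveResolvent_op hR hinj ω t).isSymmetric x (R y)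
      simp only [ContinuousLinearMap.coe_coe] at hs
      simp only [← Complex.coe_smul, inner_smul_left, inner_smul_right, inner_sub_left,
        inner_sub_right, hs, Complex.conj_ofReal]
    refine ext_inner_right ℂ fun y => ?_
    have := key y
    rw [inner_sub_right] at this
    rw [hsymm, inner_sub_left, ← this]
    simp only [← Complex.coe_smul, inner_smul_left, inner_smul_right, Complex.conj_ofReal]
    ring
  · intro h
    have := hrange (ω • x - g)
    rw [← h] at this
    simpa using this

/-! ### Uniqueness of the semigroup -/

theorem HasDerivWithinAt.norm_sq_complex {E : Type*} [NormedAddCommGroup E]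
    [InnerProductSpace ℂ E] {f : ℝ → E} {f' : E} {s : Set ℝ} {t : ℝ}
    (hf : HasDerivWithinAt f f' s t) :
    HasDerivWithinAt (fun x => ‖f x‖ ^ 2) (2 * (⟪f t, f'⟫_ℂ).re) s t := by
  have h := Complex.reCLM.hasFDerivAt.comp_hasDerivWithinAt t (hf.inner ℂ hf)
  have e : Complex.reCLM (⟪f t, f'⟫_ℂ + ⟪f', f t⟫_ℂ) = 2 * (⟪f t, f'⟫_ℂ).re := by
    rw [← inner_conj_symm f' (f t)]
    simp only [Complex.reCLM_apply, Complex.add_re, Complex.conj_re, two_mul]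
  rw [e] at h
  exact h.congr_of_eventuallyEq (.of_forall fun x => norm_sq_eq_re_inner (𝕜 := ℂ) (f x))
    (norm_sq_eq_re_inner (𝕜 := ℂ) (f t))

omit [CompleteSpace H] in
/-- A semigroup is determined by its generator if the generator is bounded above. -/
theorem C0Semigroup.ext_of_generator_eq {T S : C0Semigroup H} {ω : ℝ}
    (hTS : T.generator = S.generator)
    (hdense : Dense (T.generator.domain : Set H))
    (hdiss : ∀ x g : H, (x, g) ∈ T.generator.graph → (⟪x, g⟫_ℂ).re ≤ ω * ‖x‖ ^ 2) : T = S := by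
  have hderiv : ∀ (Q : C0Semigroup H) (x g : H), (x, g) ∈ Q.generator.graph → ∀ t : ℝ, 0 ≤ t →
      HasDerivWithinAt (fun s : ℝ => Q.op s.toNNReal x) (Q.op t.toNNReal g) (Ici t) t := by
    intro Q x g hx t ht
    rw [mem_generator_graph] at hx
    rw [hasDerivWithinAt_iff_tendsto_slope, Ici_sdiff_left]
    have h1 := ((Q.op t.toNNReal).continuous.tendsto g).comp hx
    have h2 : Tendsto (fun s : ℝ => (s - t).toNNReal) (𝓝[>] t) (𝓝[>] 0) := by
      refine tendsto_nhdsWithin_iff.2 ⟨?_, ?_⟩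
      · have h : Continuous fun s : ℝ => (s - t).toNNReal := by fun_prop
        exact (h.tendsto' t 0 (by simp)).mono_left nhdsWithin_le_nhds
      · filter_upwards [self_mem_nhdsWithin] with s hs
        simpa using hs
    refine (h1.comp h2).congr' ?_
    filter_upwards [self_mem_nhdsWithin] with s hs
    have hs' : 0 ≤ s - t := sub_nonneg.2 (le_of_lt hs)
    have e : s.toNNReal = t.toNNReal + (s - t).toNNReal := by
      rw [← Real.toNNReal_add ht hs']; congr 1; ring
    simp only [Function.comp_apply, slope_def_module, e, Q.op_add, Real.coe_toNNReal _ hs']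
    simp only [ContinuousLinearMap.comp_apply, map_sub, ContinuousLinearMap.map_smul_of_tower]
  have hgraph : ∀ (Q : C0Semigroup H) (x g : H), (x, g) ∈ Q.generator.graph → ∀ t : ℝ≥0,
      (Q.op t x, Q.op t g) ∈ Q.generator.graph := by
    intro Q x g hx t
    rw [mem_generator_graph] at hx ⊢
    refine (((Q.op t).continuous.tendsto g).comp hx).congr fun s => ?_
    have : (Q.op s).comp (Q.op t) = (Q.op t).comp (Q.op s) := by
      rw [← Q.op_add, ← Q.op_add, add_comm]
    have := DFunLike.congr_fun this x
    simp only [ContinuousLinearMap.comp_apply] at this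
    simp only [Function.comp_apply, ContinuousLinearMap.map_smul_of_tower, map_sub, this]
  have hop : ∀ t : ℝ≥0, T.op t = S.op t := by
    intro t
    refine ContinuousLinearMap.ext fun x => ?_
    refine congr_fun (Continuous.ext_on hdense (T.op t).continuous (S.op t).continuous ?_) x
    intro x hx
    obtain ⟨g, hg⟩ := LinearPMap.mem_domain_iff.1 hx
    have hg' : (x, g) ∈ S.generator.graph := hTS ▸ hg
    let u : ℝ → H := fun s => T.op s.toNNReal x - S.op s.toNNReal x
    let u' : ℝ → H := fun s => T.op s.toNNReal g - S.op s.toNNReal g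
    have hu : ∀ s : ℝ, 0 ≤ s → HasDerivWithinAt u (u' s) (Ici s) s := fun s hs =>
      (hderiv T x g hg s hs).sub (hderiv S x g hg' s hs)
    have huc : Continuous u := ((T.continuous_orbit x).comp continuous_real_toNNReal).sub
      ((S.continuous_orbit x).comp continuous_real_toNNReal)
    have hmem : ∀ s : ℝ, (u s, u' s) ∈ T.generator.graph := fun s =>
      T.generator.graph.sub_mem (hgraph T x g hg _) (hTS ▸ hgraph S x g hg' _)
    -- `(u, u')` stays in the graph, so `‖u‖ ^ 2` has right derivative at most `2 * ω * ‖u‖ ^ 2` and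
    -- starts at `0`.
    have hbound := le_gronwallBound_of_liminf_deriv_right_le (f := fun s => ‖u s‖ ^ 2)
      (f' := fun s => 2 * (⟪u s, u' s⟫_ℂ).re) (δ := 0) (K := 2 * ω) (ε := 0) (a := 0) (b := t)
      (huc.norm.pow 2).continuousOn
      (fun s hs r hr => (hu s hs.1).norm_sq_complex.liminf_right_slope_le hr)
      (by simp [u, T.op_zero, S.op_zero])
      (fun s _ => by linarith [hdiss _ _ (hmem s)])
      t ⟨t.2, le_rfl⟩
    rw [gronwallBound_ε0_δ0] at hbound
    have h0 : u t = 0 := by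
      have : ‖u t‖ ^ 2 = 0 := le_antisymm hbound (by positivity)
      simpa using this
    simpa [u, sub_eq_zero] using h0
  cases T; cases S
  congr
  exact funext hop

end Positive

/-- All powers of `p` but the zeroth equal `p`, so the series is that of `exp c` times `p`,
corrected by `1 - p` in the zeroth term. -/
theorem IsIdempotentElem.exp_smul {A : Type*} [NormedRing A] [NormedAlgebra ℂ A] [CompleteSpace A]
    {p : A} (hp : IsIdempotentElem p) (c : ℂ) :
    NormedSpace.exp (c • p) = 1 + (Complex.exp c - 1) • p := by
  have h1 := NormedSpace.exp_series_hasSum_exp' (𝕂 := ℂ) (c • p)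
  have h2 := (NormedSpace.exp_series_hasSum_exp' (𝕂 := ℂ) c).smul_const p
  rw [← Complex.exp_eq_exp_ℂ] at h2
  have h3 := h2.add (hasSum_ite_eq 0 (1 - p))
  refine h1.unique ?_
  have e : 1 + (Complex.exp c - 1) • p = Complex.exp c • p + (1 - p) := by
    rw [sub_smul, one_smul]; abel
  rw [e]
  convert h3 using 2 with n
  rcases n.eq_zero_or_pos with rfl | hn
  · simp
  · simp [hn.ne', smul_pow, hp.pow_eq hn.ne', smul_smul]

/-! ### Polarization and rotation of sesquilinear forms -/

section FormPolarization

variable {V : Type*} [NormedAddCommGroup V] [InnerProductSpace ℂ V]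
  {a : V →ₗ[ℂ] V →ₗ⋆[ℂ] ℂ}

theorem FormSymmetric.apply_eq_zero_comm (ha : FormSymmetric a) {p q : V} (h : a p q = 0) :
    a q p = 0 := by
  rw [ha, h, map_zero]

theorem FormSymmetric.apply_add_smul_self (ha : FormSymmetric a) {p q : V} (h : a p q = 0)
    {z : ℂ} (hz : ‖z‖ = 1) : a (q + z • p) (q + z • p) = a (q + p) (q + p) := by
  have h1 : z * conj z = 1 := by rw [Complex.mul_conj, Complex.normSq_eq_norm_sq, hz]; simp
  simp only [map_add, LinearMap.add_apply, map_smul, LinearMap.smul_apply, smul_eq_mul,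
    LinearMap.map_smulₛₗ, h, ha.apply_eq_zero_comm h]
  linear_combination a p p * h1

/-- Two rotations suffice: `z = -1` kills `a p q + a q p`, and then `z = I` kills `a p q - a q p`.
-/
theorem sesquilinear_eq_zero_of_rotation {p q : V}
    (h : ∀ z : ℂ, ‖z‖ = 1 → a (q + p) (q + p) = a (q + z • p) (q + z • p)) : a p q = 0 := by
  have h1 := h (-1) (by simp)
  have h2 := h Complex.I (by simp)
  simp only [map_add, LinearMap.add_apply, map_smul, LinearMap.smul_apply, smul_eq_mul,
    LinearMap.map_smulₛₗ, map_neg, map_one, Complex.conj_I] at h1 h2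
  have h3 : a p q + a q p = 0 := by linear_combination h1 / 2
  linear_combination (1 / 2 - Complex.I / 2) * h3 + (Complex.I / 2) * h2
    + ((a p q - a q p) / 2 - Complex.I / 2 * a p p) * Complex.I_mul_I

theorem sesquilinear_eq_zero_of_diag {W : Type*} [AddCommGroup W] [Module ℂ W]
    {c : W →ₗ[ℂ] W →ₗ⋆[ℂ] ℂ} (h : ∀ x, c x x = 0) (x y : W) : c x y = 0 := by
  have h1 := h (x + y)
  have h2 := h (x + Complex.I • y)
  simp only [map_add, LinearMap.add_apply, map_smul, LinearMap.smul_apply, smul_eq_mul,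
    LinearMap.map_smulₛₗ, Complex.conj_I, h] at h1 h2
  linear_combination h1 / 2 + (Complex.I / 2) * h2 + (c x y - c y x) / 2 * Complex.I_mul_I

end FormPolarization

/-! ### The resolvent of the form operator and its commutation with a projection -/

section Form

variable {H V : Type*} [NormedAddCommGroup H] [InnerProductSpace ℂ H] [CompleteSpace H]
  [NormedAddCommGroup V] [InnerProductSpace ℂ V] [CompleteSpace V]
  {j : V →L[ℂ] H} {a : V →ₗ[ℂ] V →ₗ⋆[ℂ] ℂ} {ω α : ℝ}

/-- Lax–Milgram for the shifted form `a + ω (· | ·)_H`. -/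
theorem exists_equiv_inner_eq_shiftedForm (ha_cont : FormContinuous a) (ha_symm : FormSymmetric a)
    (hα : 0 < α) (hell : ∀ f : V, α * ‖f‖ ^ 2 ≤ (a f f).re + ω * ‖j f‖ ^ 2) :
    ∃ B : V ≃L[ℂ] V, ∀ f h : V, ⟪h, B f⟫_ℂ = a f h + ω * ⟪j h, j f⟫_ℂ := by
  obtain ⟨M, hM⟩ := ha_cont
  let B₀ : V →L[ℂ] V := InnerProductSpace.continuousLinearMapOfBilin (𝕜 := ℂ)
    (LinearMap.mkContinuous₂ a.flip M fun f g => by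
      rw [LinearMap.flip_apply]; exact (hM g f).trans_eq (by ring))
  let B₁ : V →L[ℂ] V := B₀ + (ω : ℂ) • (j.adjoint.comp j)
  have hB : ∀ f h : V, ⟪h, B₁ f⟫_ℂ = a f h + ω * ⟪j h, j f⟫_ℂ := by
    intro f h
    have h1 : ⟪B₀ f, h⟫_ℂ = a h f := by simp [B₀]
    have h2 : ⟪h, B₀ f⟫_ℂ = a f h := by rw [← inner_conj_symm, h1, ← ha_symm]
    simp [B₁, h2, ContinuousLinearMap.adjoint_inner_right]
  have hunit : IsUnit B₁ := by
    refine ContinuousLinearMap.isUnit_of_forall_le_norm_inner_map B₁ (c := ⟨α, hα.le⟩) hα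
      fun f => ?_
    rw [← norm_inner_symm]
    refine le_trans ?_ (Complex.re_le_norm _)
    rw [hB, mul_comm]
    refine (hell f).trans_eq ?_
    rw [inner_self_eq_norm_sq_to_K]
    simp [← Complex.ofReal_pow]
  obtain ⟨u, hu⟩ := hunit
  exact ⟨ContinuousLinearEquiv.ofUnit u, fun f h => by rw [← hB, ← hu]; rfl⟩

/-- The solution operator of `a (f, h) + ω (f | h)_H = (y | h)_H`, as a map from `H` to `V`. -/
noncomputable def formSolution (j : V →L[ℂ] H) (B : V ≃L[ℂ] V) : H →L[ℂ] V :=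
  (B.symm : V →L[ℂ] V).comp j.adjoint

variable {B : V ≃L[ℂ] V}

theorem inner_apply_formSolution (y : H) (h : V) :
    ⟪h, B (formSolution j B y)⟫_ℂ = ⟪j h, y⟫_ℂ := by
  simp [formSolution, ContinuousLinearMap.adjoint_inner_right]

theorem eq_formSolution_iff {f : V} {y : H} :
    f = formSolution j B y ↔ ∀ h : V, ⟪h, B f⟫_ℂ = ⟪j h, y⟫_ℂ := by
  refine ⟨fun e h => by rw [e, inner_apply_formSolution], fun e => B.injective ?_⟩
  refine ext_inner_left ℂ fun h => ?_
  rw [e, inner_apply_formSolution]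

theorem denseRange_formSolution (hj : Function.Injective j) :
    DenseRange (formSolution j B) := by
  have h1 : DenseRange j.adjoint := by
    have : j.adjoint.rangeᗮ = ⊥ := by
      rw [ContinuousLinearMap.orthogonal_range, ContinuousLinearMap.adjoint_adjoint]
      exact LinearMap.ker_eq_bot.2 hj
    exact Submodule.dense_iff_topologicalClosure_eq_top.2
      ((Submodule.topologicalClosure_eq_top_iff (K := j.adjoint.range)).2 this)
  exact B.symm.surjective.denseRange.comp h1 B.symm.continuous

theorem injective_comp_formSolution (hj : Function.Injective j) (hd : DenseRange j) :
    Function.Injective (j.comp (formSolution j B)) := by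
  refine (injective_iff_map_eq_zero _).2 fun y hy => ?_
  have h0 : formSolution j B y = 0 := hj (by simpa using hy)
  refine hd.eq_zero_of_inner_right ℂ fun h => ?_
  rw [← inner_apply_formSolution (B := B), h0]
  simp

variable (hB : ∀ f h : V, ⟪h, B f⟫_ℂ = a f h + ω * ⟪j h, j f⟫_ℂ)
include hB

omit [CompleteSpace H] [CompleteSpace V] in
theorem inner_shiftedForm_symm (ha_symm : FormSymmetric a) (f h : V) :
    ⟪B h, f⟫_ℂ = ⟪h, B f⟫_ℂ := by
  rw [← inner_conj_symm, hB, hB, map_add, ← ha_symm, map_mul, inner_conj_symm, Complex.conj_ofReal]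

omit [CompleteSpace H] [CompleteSpace V] in
theorem le_re_inner_shiftedForm (hell : ∀ f : V, α * ‖f‖ ^ 2 ≤ (a f f).re + ω * ‖j f‖ ^ 2)
    (f : V) : α * ‖f‖ ^ 2 ≤ (⟪f, B f⟫_ℂ).re := by
  rw [hB]
  refine (hell f).trans_eq ?_
  rw [inner_self_eq_norm_sq_to_K]
  simp [← Complex.ofReal_pow]

theorem comp_formSolution_nonneg (ha_symm : FormSymmetric a) (hα : 0 < α)
    (hell : ∀ f : V, α * ‖f‖ ^ 2 ≤ (a f f).re + ω * ‖j f‖ ^ 2) :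
    0 ≤ j.comp (formSolution j B) := by
  rw [ContinuousLinearMap.nonneg_iff_isPositive]
  have hs : ∀ y z : H, ⟪j (formSolution j B y), z⟫_ℂ = ⟪y, j (formSolution j B z)⟫_ℂ := by
    intro y z
    rw [← inner_apply_formSolution (B := B), ← inner_shiftedForm_symm hB ha_symm,
      ← inner_conj_symm, inner_apply_formSolution, inner_conj_symm]
  refine ⟨hs, fun y => ?_⟩
  have h1 := le_re_inner_shiftedForm hB hell (formSolution j B y)
  rw [inner_apply_formSolution] at h1
  exact (by positivity : 0 ≤ α * ‖formSolution j B y‖ ^ 2).trans h1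

theorem mem_formOperator_graph_iff_resolvent (hj : Function.Injective j) (hd : DenseRange j)
    (x g : H) :
    (x, g) ∈ (formOperator j a).graph ↔ x = j.comp (formSolution j B) (ω • x - g) := by
  have key : ∀ f : V, j f = x →
      ((∀ h : V, a f h = -⟪j h, g⟫_ℂ) ↔ f = formSolution j B (ω • x - g)) := by
    rintro f rfl
    rw [eq_formSolution_iff]
    refine forall_congr' fun h => ?_
    rw [hB, inner_sub_right, ← Complex.coe_smul, inner_smul_right]
    constructor <;> intro e <;> linear_combination e
  rw [mem_formOperator_graph hj hd]
  constructor
  · rintro ⟨f, hf, hfg⟩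
    rw [ContinuousLinearMap.comp_apply, ← (key f hf).1 hfg, hf]
  · intro hx
    exact ⟨formSolution j B (ω • x - g), hx.symm, (key _ hx.symm).2 rfl⟩

/-- On the range of `S` the wanted map is `S y ↦ S (P y)`. Commutation makes `S y - S (P y)`
orthogonal to `S (P y)` for the shifted form; coercivity then bounds the map in `V`, and it passes
to limits. -/
theorem exists_form_projection_of_commute {P : H →L[ℂ] H} (hP : IsStarProjection P)
    (hj : Function.Injective j) (hα : 0 < α)
    (hell : ∀ f : V, α * ‖f‖ ^ 2 ≤ (a f f).re + ω * ‖j f‖ ^ 2)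
    (hcomm : ∀ y, P (j (formSolution j B y)) = j (formSolution j B (P y))) (ψ : V) :
    ∃ φ : V, j φ = P (j ψ) ∧ a φ ψ = a φ φ := by
  have hPP : ∀ x, P (P x) = P x := fun x => DFunLike.congr_fun hP.isIdempotentElem.eq x
  have hPs : ∀ x y, ⟪P x, y⟫_ℂ = ⟪x, P y⟫_ℂ := hP.isSelfAdjoint.isSymmetric
  set S := formSolution j B with hS
  have horth : ∀ y, ⟪S y - S (P y), B (S (P y))⟫_ℂ = 0 := by
    intro y
    rw [inner_apply_formSolution, map_sub, ← hcomm, ← hPs, map_sub, hPP, sub_self,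
      inner_zero_left]
  have hbd : ∀ y, ‖S (P y)‖ ≤ ‖(B : V →L[ℂ] V)‖ / α * ‖S y‖ := by
    intro y
    rcases (norm_nonneg (S (P y))).eq_or_lt with h0 | h0
    · rw [← h0]; positivity
    · rw [div_mul_eq_mul_div, le_div_iff₀ hα]
      refine le_of_mul_le_mul_right ?_ h0
      have h1 := horth y
      rw [inner_sub_left, sub_eq_zero] at h1
      calc ‖S (P y)‖ * α * ‖S (P y)‖ = α * ‖S (P y)‖ ^ 2 := by ring
        _ ≤ (⟪S y, B (S (P y))⟫_ℂ).re := by rw [h1]; exact le_re_inner_shiftedForm hB hell _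
        _ ≤ ‖S y‖ * ‖B (S (P y))‖ := (Complex.re_le_norm _).trans (norm_inner_le_norm _ _)
        _ ≤ ‖S y‖ * (‖(B : V →L[ℂ] V)‖ * ‖S (P y)‖) := by
          gcongr; exact (B : V →L[ℂ] V).le_opNorm _
        _ = _ := by ring
  obtain ⟨u, hu, hlim⟩ := mem_closure_iff_seq_limit.1 (denseRange_formSolution (B := B) hj ψ)
  choose y hy using hu
  have hy' : Tendsto (fun n => S (y n)) atTop (𝓝 ψ) := by simpa only [hS, hy] using hlim
  have hcauchy : CauchySeq fun n => S (P (y n)) := by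
    set C := ‖(B : V →L[ℂ] V)‖ / α with hC
    have hC0 : 0 ≤ C := by positivity
    refine Metric.cauchySeq_iff'.2 fun ε hε => ?_
    -- `C + 1` rather than `C`, because `C` may vanish.
    obtain ⟨N, hN⟩ := Metric.cauchySeq_iff'.1 hy'.cauchySeq (ε / (C + 1)) (by positivity)
    refine ⟨N, fun n hn => ?_⟩
    have h1 := hN n hn
    rw [lt_div_iff₀ (by positivity), dist_eq_norm] at h1
    have h2 := hbd (y n - y N)
    simp only [map_sub] at h2
    rw [dist_eq_norm]
    nlinarith [norm_nonneg (S (y n) - S (y N))]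
  obtain ⟨φ, hφ⟩ := cauchySeq_tendsto_of_complete hcauchy
  have hjφ : j φ = P (j ψ) := by
    refine tendsto_nhds_unique ((j.continuous.tendsto φ).comp hφ) ?_
    refine ((P.continuous.comp j.continuous).tendsto ψ |>.comp hy').congr fun n => ?_
    exact hcomm (y n)
  refine ⟨φ, hjφ, ?_⟩
  have h0 : ⟪ψ - φ, B φ⟫_ℂ = 0 := by
    refine tendsto_nhds_unique ((hy'.sub hφ).inner ((B.continuous.tendsto φ).comp hφ)) ?_
    refine tendsto_const_nhds.congr fun n => ?_
    exact (horth (y n)).symm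
  -- The `ω` term drops out because `P` annihilates `j ψ - P (j ψ)`, leaving orthogonality for `a`
  -- itself.
  rw [hB, map_sub j, hjφ, ← hPs, map_sub P, hPP, sub_self, inner_zero_left, mul_zero, add_zero,
    map_sub, sub_eq_zero] at h0
  exact h0

theorem commute_of_exists_form_projection {P : H →L[ℂ] H} (hP : IsStarProjection P)
    (hj : Function.Injective j) (ha_symm : FormSymmetric a)
    (h : ∀ ψ : V, ∃ φ : V, j φ = P (j ψ) ∧ a φ ψ = a φ φ) (y : H) :
    P (j (formSolution j B y)) = j (formSolution j B (P y)) := by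
  have hPs : ∀ x y, ⟪P x, y⟫_ℂ = ⟪x, P y⟫_ℂ := hP.isSelfAdjoint.isSymmetric
  choose p hp hpa using h
  let Q : V →ₗ[ℂ] V :=
    { toFun := p
      map_add' := fun x z => hj (by simp [hp])
      map_smul' := fun c x => hj (by simp [hp]) }
  have hdiag : ∀ x, ((a.comp Q).compl₂ (LinearMap.id - Q)) x x = 0 := fun x => by
    simpa [sub_eq_zero, Q] using hpa x
  have hpol : ∀ x z, a (p x) z = a (p x) (p z) := fun x z => by
    simpa [sub_eq_zero, Q] using sesquilinear_eq_zero_of_diag hdiag x z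
  -- Both sides equal `a (p x) (p z)`: `p` is symmetric for `a`, hence for the shifted form, and the
  -- weak equation of `S` yields the commutation.
  have hmove : ∀ x z, a (p x) z = a x (p z) := fun x z => by
    rw [hpol, ha_symm, ← hpol, ← ha_symm]
  have key : p (formSolution j B y) = formSolution j B (P y) := by
    refine eq_formSolution_iff.2 fun h => ?_
    have h1 := inner_apply_formSolution (j := j) (B := B) y (p h)
    rw [hB, ← hmove, hp, hPs, hPs, ← hp] at h1
    rw [hB, h1]
  rw [← hp, key]

end Form

/-! ### Invariance as commutation, and the equivalences -/

theorem C0Semigroup.commute_resolvent_of_commute_op {H : Type*} [NormedAddCommGroup H]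
    [InnerProductSpace ℂ H] {T : C0Semigroup H} {R P : H →L[ℂ] H} {ω : ℝ}
    (hgraph : ∀ x g : H, (x, g) ∈ T.generator.graph ↔ x = R (ω • x - g))
    (hcomm : ∀ t x, T.op t (P x) = P (T.op t x)) (y : H) : P (R y) = R (P y) := by
  have h1 : (R y, ω • R y - y) ∈ T.generator.graph := (hgraph _ _).2 (by simp)
  have h2 : (P (R y), P (ω • R y - y)) ∈ T.generator.graph := by
    rw [mem_generator_graph] at h1 ⊢
    refine ((P.continuous.tendsto _).comp h1).congr fun t => ?_
    simp [hcomm]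
  have h3 := (hgraph _ _).1 h2
  simpa using h3

/-- Invariance reads `P U P = U P`; its left side is self-adjoint, so taking adjoints gives `U P = P
U`. -/
theorem IsStarProjection.commute_of_range_invariant {H : Type*} [NormedAddCommGroup H]
    [InnerProductSpace ℂ H] [CompleteSpace H] {P U : H →L[ℂ] H} (hP : IsStarProjection P)
    (hU : IsSelfAdjoint U) (h : ∀ x ∈ P.range, U x ∈ P.range) : Commute U P := by
  have h1 : P * (U * P) = U * P := by
    ext x
    obtain ⟨z, hz⟩ := h (P x) ⟨x, rfl⟩
    have hz' : P z = U (P x) := hz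
    simp only [mul_apply_eq_comp]
    rw [← hz']
    exact DFunLike.congr_fun hP.isIdempotentElem.eq z
  have h2 := congrArg star h1
  simp only [star_mul, hU.star_eq, hP.isSelfAdjoint.star_eq] at h2
  rw [Commute, SemiconjBy, ← h1, ← h2, mul_assoc]

theorem proposition1
    {H : Type*} [NormedAddCommGroup H] [InnerProductSpace ℂ H] [CompleteSpace H]
    {V : Type*} [NormedAddCommGroup V] [InnerProductSpace ℂ V] [CompleteSpace V]
    (j : V →L[ℂ] H) (hj_inj : Function.Injective j) (hj_dense : DenseRange j)
    (a : V →ₗ[ℂ] V →ₗ⋆[ℂ] ℂ)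
    (ha_cont : FormContinuous a) (ha_ell : FormElliptic j a) (ha_symm : FormSymmetric a)
    (P : H →L[ℂ] H) (hP : IsStarProjection P) :
    (∃! T : C0Semigroup H, T.generator = formOperator j a) ∧
    ∀ T : C0Semigroup H, T.generator = formOperator j a →
      List.TFAE
        [∀ t : ℝ≥0, ∀ x ∈ P.range, T.op t x ∈ P.range,
         ∀ ψ : V, ∃ φ : V, j φ = P (j ψ) ∧ a φ ψ = a φ φ,
         ∀ ψ : V, ∀ s : ℝ, ∃ φ : V,
           j φ = NormedSpace.exp ((Complex.I * (s : ℂ)) • P) (j ψ) ∧ a ψ ψ = a φ φ] := by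
  obtain ⟨ω, α, hα, hell⟩ := ha_ell
  obtain ⟨B, hB⟩ := exists_equiv_inner_eq_shiftedForm (j := j) ha_cont ha_symm hα hell
  set R : H →L[ℂ] H := j.comp (formSolution j B) with hRdef
  have hR : 0 ≤ R := comp_formSolution_nonneg hB ha_symm hα hell
  have hinj : Function.Injective R := injective_comp_formSolution hj_inj hj_dense
  have hgraph : ∀ x g, (x, g) ∈ (formOperator j a).graph ↔ x = R (ω • x - g) :=
    mem_formOperator_graph_iff_resolvent hB hj_inj hj_dense
  let T₀ := C0Semigroup.ofPositiveResolvent R hR hinj ω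
  have hT₀ : T₀.generator = formOperator j a := by
    refine LinearPMap.eq_of_eq_graph (Submodule.ext fun ⟨x, g⟩ => ?_)
    rw [C0Semigroup.mem_graph_ofPositiveResolvent, hgraph]
  have huniq : ∀ T : C0Semigroup H, T.generator = formOperator j a → T = T₀ := by
    intro T hT
    refine C0Semigroup.ext_of_generator_eq (ω := ω) (hT.trans hT₀.symm) ?_ ?_
    · rw [hT]
      refine (denseRange_of_nonneg_of_injective hR hinj).mono ?_
      rintro _ ⟨y, rfl⟩
      exact LinearPMap.mem_domain_iff.2 ⟨ω • R y - y, (hgraph _ _).2 (by simp)⟩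
    · intro x g hx
      rw [hT, hgraph] at hx
      -- With `v = ω • x - g` and `x = R v`, positivity of `R` at `v` is exactly the upper bound for
      -- the generator.
      have h1 := ((ContinuousLinearMap.nonneg_iff_isPositive R).1 hR).re_inner_nonneg_left
        (ω • x - g)
      rw [← hx, inner_sub_right, ← Complex.coe_smul, inner_smul_right,
        inner_self_eq_norm_sq_to_K] at h1
      simpa [← Complex.ofReal_pow] using h1
  refine ⟨⟨T₀, hT₀, huniq⟩, fun T hT => ?_⟩
  obtain rfl := huniq T hT
  have hPR : (∀ y, P (R y) = R (P y)) ↔ ∀ t : ℝ≥0, ∀ x ∈ P.range, T₀.op t x ∈ P.range := by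
    constructor
    · rintro h t _ ⟨x, rfl⟩
      have hc : Commute R P := ContinuousLinearMap.ext fun y => (h y).symm
      have h1 := DFunLike.congr_fun (commute_expNegInv hc t).eq x
      refine ⟨T₀.op t x, ?_⟩
      simp only [mul_apply_eq_comp] at h1
      simp [T₀, C0Semigroup.ofPositiveResolvent_op, h1]
    · intro h
      refine C0Semigroup.commute_resolvent_of_commute_op (T := T₀) (ω := ω)
        (fun x g => by rw [hT₀, hgraph]) fun t x => ?_
      have hU := C0Semigroup.isSelfAdjoint_ofPositiveResolvent_op hR hinj ω t
      exact DFunLike.congr_fun (hP.commute_of_range_invariant hU (h t)).eq x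
  have hexp : ∀ (ψ : V) (s : ℝ), NormedSpace.exp ((Complex.I * (s : ℂ)) • P) (j ψ)
      = j ψ - P (j ψ) + Complex.exp (s * Complex.I) • P (j ψ) := by
    intro ψ s
    rw [hP.isIdempotentElem.exp_smul, mul_comm]
    simp [sub_smul]
    abel
  tfae_have 1 → 2 := fun h =>
    exists_form_projection_of_commute hB hP hj_inj hα hell (hPR.2 h)
  tfae_have 2 → 1 := fun h =>
    hPR.1 (commute_of_exists_form_projection hB hP hj_inj ha_symm h)
  tfae_have 2 → 3 := by
    intro h ψ s
    obtain ⟨p, hp, hpa⟩ := h ψ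
    have hpq : a p (ψ - p) = 0 := by rw [map_sub, hpa, sub_self]
    refine ⟨ψ - p + Complex.exp (s * Complex.I) • p, by simp [hexp, hp], ?_⟩
    rw [ha_symm.apply_add_smul_self hpq (Complex.norm_exp_ofReal_mul_I s), sub_add_cancel]
  tfae_have 3 → 2 := by
    intro h ψ
    -- At `s = π` the exponential is `1 - 2 P`, so `P (j ψ)` is half the difference of two vectors
    -- coming from `V`.
    obtain ⟨φ, hφ, -⟩ := h ψ Real.pi
    rw [hexp, Complex.exp_pi_mul_I] at hφ
    have hp : j ((1 / 2 : ℂ) • (ψ - φ)) = P (j ψ) := by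
      rw [map_smul, map_sub, hφ]
      module
    set p : V := (1 / 2 : ℂ) • (ψ - φ)
    refine ⟨p, hp, ?_⟩
    have hpq : a p (ψ - p) = 0 := by
      refine sesquilinear_eq_zero_of_rotation fun z hz => ?_
      obtain ⟨χ, hχ, hχa⟩ := h ψ (Complex.arg z)
      have hz' : Complex.exp (Complex.arg z * Complex.I) = z := by
        simpa [hz] using Complex.norm_mul_exp_arg_mul_I z
      have e : χ = ψ - p + z • p := hj_inj (by rw [hχ, hexp, hz']; simp [hp])
      rw [sub_add_cancel, hχa, e]
    rwa [map_sub, sub_eq_zero] at hpq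
  tfae_finish
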